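/- Let $\Gamma$ be a countably infinite group and let $k \ge 2$ be an integer. Equip $k^\Gamma=\{0,\dots,k-1\}^\Gamma$ with the product topology and with the shift action $(\gamma\cdot x)(\delta)=x(\delta\gamma)$. A subshift is a closed shift-invariant subset $X\subseteq k^\Gamma$; it is free if $\gamma\cdot x=x$ with $x\in X$ implies $\gamma=\mathbf 1$, and minimal if it is nonempty and contains no nonempty subshift other than itself. For a finite set $F\subseteq\Gamma$ let $X_F=\{x|_F : x\in X\}$. Let $U\subseteq k^\Gamma$ be a nonempty shift-invariant open set and let $h<\log_2 k$ be a real number. Then: (i) There is a free minimal subshift $X\subseteq U$ of Hausdorff dimension at least $h$. Here the dimension is taken with respect to the metric $\operatorname{dist}(x,y)=2^{-\min\{i\,:\,x(\gamma_i)\neq y(\gamma_i)\}}$ (for $x\ne y$) given by an enumeration $\gamma_0,\gamma_1,\dots$ of $\Gamma$ without repetitions, and one $X$ works for all enumerations. (ii) If $\Gamma$ is amenable, then there is a free minimal subshift $X\subseteq U$ of topological entropy at least $h$; that is, for every Følner sequence $(F_n)$ (nonempty finite sets $F_n \subseteq \Gamma$ with $|\gamma F_n\bigtriangleup F_n|/|F_n|\to0$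 for all $\gamma\in\Gamma$) we have $\liminf_{n\to\infty}\log_2|X_{F_n}|/|F_n|\ge h$. (By the Ornstein--Weiss theorem this lower limit is a limit and does not depend on the Følner sequence; its value is the entropy.) (iii) If $\Gamma$ is sofic, then there is a nonempty free subshift $X\subseteq U$ such that $h(X,\Sigma)\ge h$ for every sofic approximation $\Sigma$ to $\Gamma$. In (iii), a pseudo-action of $\Gamma$ on a set $V$ is an arbitrary map $\alpha:\Gamma\times V\to V$, $(\gamma,v)\mapsto\gamma\cdot v$. For $F\subseteq\Gamma$, a point $v\in V$ is $F$-proper if $\mathbf 1\cdot v=v$; $\gamma\cdot(\delta\cdot v)=(\gamma\delta)\cdot v$ whenever $\gamma,\delta,\gamma\delta\in F$; and $\gamma\cdot v\neq\delta\cdot v$ for distinct $\gamma,\delta\in F$. A sofic approximation is a sequence $\Sigma=(\alpha_n)$ of pseudo-actions on nonempty finite sets $V_n$ such that for all $\varepsilon>0$ and finite $F\subseteq\Gamma$, for all but finitely many $n$, at least $(1-\varepsilon)|V_n|$ points of $V_n$ are $F$-proper; $\Gamma$ is sofic if it has one. For $\varepsilon>0$ and finite $F \subseteq \Gamma$, let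 $\mathrm{Col}_{\varepsilon,F}(\alpha_n,X)$ be the set of all $f:V_n\to\{0,\dots,k-1\}$ such that for at least $(1-\varepsilon)|V_n|$ points $v\in V_n$ the map $F\to k$, $\gamma\mapsto f(\gamma\cdot v)$, belongs to $X_F$. Then $$h(X,\Sigma)=\inf_{\varepsilon>0,\;F}\ \limsup_{n\to\infty}\ \frac{\log_2|\mathrm{Col}_{\varepsilon,F}(\alpha_n,X)|}{|V_n|},$$ where $F$ ranges over the finite subsets of $\Gamma$ and the quotient is $-\infty$ if $\mathrm{Col}_{\varepsilon,F}(\alpha_n,X)=\varnothing$. -/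

import Mathlib

open Filter Topology MeasureTheory
open scoped ENNReal symmDiff

noncomputable section

namespace LargeSubshift

/-! ### Subshifts -/

/-- The shift action on `A ^ Γ`: `(γ · x)(δ) = x (δ γ)`. -/
def shift {Γ A : Type*} [Group Γ] (γ : Γ) (x : Γ → A) : Γ → A := fun δ => x (δ * γ)

theorem shift_one {Γ A : Type*} [Group Γ] (x : Γ → A) : shift (1 : Γ) x = x := by
  funext δ; simp [shift]

theorem shift_mul {Γ A : Type*} [Group Γ] (γ η : Γ) (x : Γ → A) :
    shift (γ * η) x = shift γ (shift η x) := by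
  funext δ; simp [shift, mul_assoc]

/-- `X` is invariant under the shift action. -/
def ShiftInvariant {Γ A : Type*} [Group Γ] (X : Set (Γ → A)) : Prop :=
  ∀ γ : Γ, ∀ x ∈ X, shift γ x ∈ X

/-- A subshift of `k ^ Γ`: a closed shift-invariant set (product topology, discrete alphabet). -/
structure IsSubshift {Γ : Type*} [Group Γ] {k : ℕ} (X : Set (Γ → Fin k)) : Prop where
  isClosed : IsClosed X
  invariant : ShiftInvariant X

/-- A minimal subshift: nonempty, with no nonempty proper sub-subshift. -/
structure IsMinimalSubshift {Γ : Type*} [Group Γ] {k : ℕ} (X : Set (Γ → Fin k)) : Prop where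
  isSubshift : IsSubshift X
  nonempty : X.Nonempty
  minimal : ∀ Y : Set (Γ → Fin k), IsSubshift Y → Y.Nonempty → Y ⊆ X → Y = X

/-- Every point of `X` has trivial stabilizer. -/
def IsFree {Γ : Type*} [Group Γ] {k : ℕ} (X : Set (Γ → Fin k)) : Prop :=
  ∀ γ : Γ, ∀ x ∈ X, shift γ x = x → γ = 1

/-- `X_F`, the set of restrictions to `F` of the points of `X`. -/
def patterns {Γ : Type*} {k : ℕ} (X : Set (Γ → Fin k)) (F : Finset Γ) : Set (F → Fin k) :=
  F.restrict '' X

/-! ### Hausdorff dimension -/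

/-- The metric on `k ^ Γ` attached to an enumeration `γ₀, γ₁, …` of `Γ`: for `x ≠ y`, the distance
is `2 ^ (-n)` where `n` is the least index with `x γₙ ≠ y γₙ` (see `enumMetric_dist`). -/
@[reducible] def enumMetric {Γ : Type*} {k : ℕ} (e : ℕ ≃ Γ) : MetricSpace (Γ → Fin k) :=
  MetricSpace.induced (fun (x : Γ → Fin k) (n : ℕ) => x (e n))
    (fun x y hxy => funext fun γ => by simpa using congrFun hxy (e.symm γ))
    PiNat.metricSpace

theorem enumMetric_dist {Γ : Type*} {k : ℕ} (e : ℕ ≃ Γ) {x y : Γ → Fin k} (hxy : x ≠ y) :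
    (enumMetric e).dist x y = (1 / 2 : ℝ) ^ sInf {n : ℕ | x (e n) ≠ y (e n)} := by
  have hne : (fun n : ℕ => x (e n)) ≠ fun n => y (e n) := fun h =>
    hxy (funext fun γ => by simpa using congrFun h (e.symm γ))
  have h1 : (enumMetric e).dist x y =
      (1 / 2 : ℝ) ^ PiNat.firstDiff (fun n : ℕ => x (e n)) (fun n => y (e n)) :=
    PiNat.dist_eq_of_ne hne
  rw [h1]
  congr 1
  have hmem := PiNat.apply_firstDiff_ne hne
  refine le_antisymm ?_ (Nat.sInf_le hmem)
  by_contra! hlt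
  exact Nat.sInf_mem (s := {n : ℕ | x (e n) ≠ y (e n)}) ⟨_, hmem⟩
    (PiNat.apply_eq_of_lt_firstDiff hlt)

/-- The Hausdorff dimension of `X ⊆ k ^ Γ` with respect to the metric given by `e`. -/
def hausdorffDim {Γ : Type*} {k : ℕ} (e : ℕ ≃ Γ) (X : Set (Γ → Fin k)) : ℝ≥0∞ :=
  letI : MetricSpace (Γ → Fin k) := enumMetric e
  dimH X

/-! ### Entropy for amenable groups -/

/-- A Følner sequence: nonempty finite sets `F n` with `|γ F n ∆ F n| / |F n| → 0` for all `γ`. -/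
structure IsFolnerSeq {Γ : Type*} [Group Γ] (F : ℕ → Finset Γ) : Prop where
  nonempty : ∀ n, (F n).Nonempty
  tendsto : ∀ γ : Γ,
    Tendsto (fun n => ((((fun δ => γ * δ) '' (F n : Set Γ)) ∆ (F n : Set Γ)).ncard : ℝ) / (F n).card)
      atTop (𝓝 0)

/-- A (countable) group is amenable if it admits a Følner sequence. -/
def IsAmenable (Γ : Type*) [Group Γ] : Prop := ∃ F : ℕ → Finset Γ, IsFolnerSeq F

/-- The topological entropy of a nonempty subshift `X`, computed along the Følner sequence `F`:
the limit of `log₂ |X_{F n}| / |F n|`. This limit always exists and does not depend on `F`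
(Ornstein and Weiss), so that taking the lower limit is the same; it avoids a junk value. -/
def folnerEntropy {Γ : Type*} {k : ℕ} (F : ℕ → Finset Γ) (X : Set (Γ → Fin k)) : EReal :=
  liminf (fun n => ((Real.logb 2 (patterns X (F n)).ncard / (F n).card : ℝ) : EReal)) atTop

theorem folnerEntropy_eq_of_tendsto {Γ : Type*} {k : ℕ} {F : ℕ → Finset Γ} {X : Set (Γ → Fin k)}
    {l : ℝ}
    (hl : Tendsto (fun n => Real.logb 2 (patterns X (F n)).ncard / (F n).card) atTop (𝓝 l)) :
    folnerEntropy F X = (l : EReal) :=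
  (EReal.tendsto_coe.mpr hl).liminf_eq

/-! ### Entropy for sofic groups -/

/-- `v` is `F`-proper for the pseudo-action (that is, arbitrary map) `α : Γ → V → V`. -/
structure IsProper {Γ V : Type*} [Group Γ] (α : Γ → V → V) (F : Set Γ) (v : V) : Prop where
  identity : α 1 v = v
  equivariance : ∀ γ ∈ F, ∀ δ ∈ F, γ * δ ∈ F → α γ (α δ v) = α (γ * δ) v
  freeness : ∀ γ ∈ F, ∀ δ ∈ F, α γ v = α δ v → γ = δ

/-- The pseudo-action `α` on the finite set `V` is `(ε, F)`-faithful. -/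
def IsFaithful {Γ V : Type*} [Group Γ] (α : Γ → V → V) (ε : ℝ) (F : Set Γ) : Prop :=
  (1 - ε) * (Nat.card V : ℝ) ≤ ({v : V | IsProper α F v}.ncard : ℝ)

/-- A sofic approximation to `Γ`: a sequence of pseudo-actions on nonempty finite sets, such that
for all `ε > 0` and finite `F ⊆ Γ` all but finitely many of them are `(ε, F)`-faithful. -/
structure SoficApproximation (Γ : Type*) [Group Γ] where
  /-- the finite sets -/
  V : ℕ → Type
  finite : ∀ n, Finite (V n)
  nonempty : ∀ n, Nonempty (V n)
  /-- the pseudo-actions -/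
  act : ∀ n, Γ → V n → V n
  faithful : ∀ ε : ℝ, 0 < ε → ∀ F : Finset Γ, ∀ᶠ n in atTop, IsFaithful (act n) ε (F : Set Γ)

/-- A group is sofic if it admits a sofic approximation. -/
def IsSofic (Γ : Type*) [Group Γ] : Prop := Nonempty (SoficApproximation Γ)

/-- The map `π_f : V → k ^ Γ`, `π_f(v)(γ) = f (γ · v)`. -/
def codingMap {Γ V : Type*} {k : ℕ} (α : Γ → V → V) (f : V → Fin k) (v : V) : Γ → Fin k :=
  fun γ => f (α γ v)

/-- The set of `(ε, F)`-approximate `X`-colorings of the pseudo-action `α`. -/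
def approxColorings {Γ V : Type*} {k : ℕ} (ε : ℝ) (F : Finset Γ) (α : Γ → V → V)
    (X : Set (Γ → Fin k)) : Set (V → Fin k) :=
  {f | (1 - ε) * (Nat.card V : ℝ) ≤
    ({v : V | F.restrict (codingMap α f v) ∈ patterns X F}.ncard : ℝ)}

open Classical in
/-- `h_{ε,F}(X, α) = log₂ |Col_{ε,F}(α, X)| / |V|`, and `-∞` if there are no such colorings. -/
def approxEntropy {Γ V : Type*} {k : ℕ} (ε : ℝ) (F : Finset Γ) (X : Set (Γ → Fin k))
    (α : Γ → V → V) : EReal :=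
  if approxColorings ε F α X = ∅ then ⊥
  else ((Real.logb 2 (approxColorings ε F α X).ncard / (Nat.card V : ℝ) : ℝ) : EReal)

/-- The topological entropy of `X` with respect to the sofic approximation `S`:
the infimum over `ε > 0` and finite `F ⊆ Γ` of `limsup_n h_{ε,F}(X, α_n)`. -/
def soficEntropy {Γ : Type*} [Group Γ] {k : ℕ} (X : Set (Γ → Fin k))
    (S : SoficApproximation Γ) : EReal :=
  ⨅ (ε : ℝ) (_ : 0 < ε) (F : Finset Γ),
    limsup (fun n => approxEntropy ε F X (S.act n)) atTop

end LargeSubshift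

end

/-! Fix `β` slightly above `1/k` and give a finite pattern `P` the weight `β ^ |P|`. The proof
builds one subshift, defined by forbidden patterns, in which every finite family of patterns of
total weight `< 1` is avoided by some translate of each point.

Existence comes from a local-lemma-type count: if `∑ |P| β ^ |P| ≤ kβ - 1` over the forbidden
patterns, then adding a vertex multiplies the number of admissible colorings by at least `β⁻¹`
(`ncard_avoiding_insert`). The count works along any sufficiently faithful pseudo-action, which
gives the sofic entropy bound `log₂ β⁻¹` directly.

Demanding that some translate avoid a family `Φ` of weight `q < 1` costs almost nothing
(`IsAmplifiable.exists_light`). Take `n` translates of `Φ` with disjoint supports and forbid every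
union of one pattern from each. The total weight is at most `q ^ n`, the sizes grow linearly in `n`,
and a point avoiding all the unions must avoid one whole translate. So countably many such demands
fit into the budget `kβ - 1`.

The demands do the rest. A cylinder inside `U` has complement of weight `< 1`, so every orbit enters
`U`. The equal-value patterns on `{δ, δγ}` have weight `kβ² < 1`, so no `γ ≠ 1` is a period.
Finally, no nonempty subsystem, in particular no minimal one, has a cover by cylinders of weight `<
1`; this bounds both its Hausdorff dimension and its pattern counts from below. -/

noncomputable section

namespace LargeSubshift

/-! ### Counting colorings that avoid partial colorings -/

/-- The coloring `f` agrees with the finite partial coloring whose graph is `P`. -/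
def Matches {V A : Type*} (P : Finset (V × A)) (f : V → A) : Prop := ∀ p ∈ P, f p.1 = p.2

/-- The colorings equal to `a₀` off `S` that match no member of `E` supported in `S`. -/
def avoiding {V A : Type*} (a₀ : A) (E : Set (Finset (V × A))) (S : Finset V) : Set (V → A) :=
  {f | (∀ v ∉ S, f v = a₀) ∧ ∀ b ∈ E, (∀ p ∈ b, p.1 ∈ S) → ¬ Matches b f}

theorem Matches.congr {V A : Type*} {P : Finset (V × A)} {f g : V → A} (h : Matches P f)
    (hfg : ∀ p ∈ P, f p.1 = g p.1) : Matches P g :=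
  fun p hp => (hfg p hp).symm.trans (h p hp)

theorem Matches.injOn_fst {V A : Type*} {P : Finset (V × A)} {f : V → A} (h : Matches P f) :
    Set.InjOn Prod.fst (P : Set (V × A)) := fun p hp q hq hpq =>
  Prod.ext hpq (by rw [← h p hp, ← h q hq, hpq])

theorem finite_eq_off {V A : Type*} [Finite A] (a₀ : A) (S : Finset V) :
    {f : V → A | ∀ v ∉ S, f v = a₀}.Finite := by
  refine Set.Finite.of_finite_image (f := fun f => S.restrict f) (Set.toFinite _) ?_
  intro f hf g hg hfg
  funext v
  by_cases hv : v ∈ S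
  · exact congrFun hfg ⟨v, hv⟩
  · rw [hf v hv, hg v hv]

theorem avoiding_finite {V A : Type*} [Finite A] (a₀ : A) (E : Set (Finset (V × A)))
    (S : Finset V) : (avoiding a₀ E S).Finite :=
  (finite_eq_off a₀ S).subset fun _ hf => hf.1

/-- One-vertex extensions: avoiding colorings grow by a factor `β⁻¹`. -/
theorem ncard_avoiding_insert {V A : Type*} [DecidableEq V] [Fintype A] (a₀ : A)
    (E : Set (Finset (V × A))) {β : ℝ} (hβ : 0 < β)
    (S : Finset V) (v : V) (hv : v ∉ S) (N : Finset (Finset (V × A)))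
    (hN : ∀ b ∈ E, (∃ p ∈ b, p.1 = v) → b ∈ N)
    (hsum : ∑ b ∈ N, β ^ b.card ≤ Fintype.card A * β - 1)
    (hS : ∀ R ⊆ S, ((avoiding a₀ E R).ncard : ℝ) ≤ β ^ (S.card - R.card) * (avoiding a₀ E S).ncard) :
    ((avoiding a₀ E S).ncard : ℝ) ≤ β * (avoiding a₀ E (insert v S)).ncard := by
  classical
  set g : ℝ := ((avoiding a₀ E S).ncard : ℝ) with hg
  -- Impose only the constraints inside `S`, leaving the value at `v` free: this gives at least `|A|
  -- g` colorings. Those that fail on `insert v S` match some `b` through `v` and land in `C b`.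
  let X : Set (V → A) :=
    {f | (∀ w ∉ insert v S, f w = a₀) ∧ ∀ b ∈ E, (∀ p ∈ b, p.1 ∈ S) → ¬ Matches b f}
  have hXfin : X.Finite := (finite_eq_off a₀ (insert v S)).subset fun _ hf => hf.1
  have hXcard : (Fintype.card A : ℝ) * g ≤ X.ncard := by
    have h1 : ((avoiding a₀ E S) ×ˢ (Set.univ : Set A)).ncard ≤ X.ncard := by
      refine Set.ncard_le_ncard_of_injOn (fun q => Function.update q.1 v q.2) ?_ ?_ hXfin
      · rintro ⟨f, a⟩ ⟨hf, -⟩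
        refine ⟨fun w hw => ?_, fun b hb hbS hm => hf.2 b hb hbS (hm.congr fun p hp => ?_)⟩
        · rw [Finset.mem_insert, not_or] at hw
          simpa [Function.update_of_ne hw.1] using hf.1 w hw.2
        · exact (Function.update_of_ne (ne_of_mem_of_not_mem (hbS p hp) hv) _ _)
      · rintro ⟨f, a⟩ ⟨hf, -⟩ ⟨f', a'⟩ ⟨hf', -⟩ h
        have h' : Function.update f v a = Function.update f' v a' := h
        have ha : a = a' := by simpa using congrFun h' v
        have hff : f = f' := by
          funext w
          by_cases hw : w = v
          · rw [hw]; exact (hf.1 v hv).trans (hf'.1 v hv).symm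
          · simpa [hw] using congrFun h' w
        rw [ha, hff]
    rw [Set.ncard_prod, Set.ncard_univ, Nat.card_eq_fintype_card] at h1
    rw [mul_comm, hg]
    exact_mod_cast h1
  let C : Finset (V × A) → Set (V → A) := fun b =>
    {f ∈ X | Matches b f ∧ (∀ p ∈ b, p.1 ∈ insert v S) ∧ (∃ p ∈ b, p.1 = v)}
  have hcover : X ⊆ avoiding a₀ E (insert v S) ∪ ⋃ b ∈ N, C b := by
    intro f hf
    by_cases hfa : f ∈ avoiding a₀ E (insert v S)
    · exact Or.inl hfa
    · right
      have : ∃ b ∈ E, (∀ p ∈ b, p.1 ∈ insert v S) ∧ Matches b f := by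
        by_contra! hcon
        exact hfa ⟨hf.1, hcon⟩
      obtain ⟨b, hb, hbS, hm⟩ := this
      have hbv : ∃ p ∈ b, p.1 = v := by
        by_contra! hcon
        exact hf.2 b hb (fun p hp => (Finset.mem_insert.mp (hbS p hp)).resolve_left (hcon p hp)) hm
      simp only [Set.mem_iUnion]
      exact ⟨b, hN b hb hbv, hf, hm, hbS, hbv⟩
  have hC : ∀ b ∈ N, ((C b).ncard : ℝ) ≤ β⁻¹ * g * β ^ b.card := by
    intro b _
    rcases (C b).eq_empty_or_nonempty with h0 | ⟨f₀, hf₀⟩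
    · rw [h0]; simp only [Set.ncard_empty, Nat.cast_zero]; positivity
    obtain ⟨-, hm₀, hbS, hbv⟩ := hf₀
    set D := b.image Prod.fst with hD
    have hDc : D.card = b.card := Finset.card_image_of_injOn hm₀.injOn_fst
    have hDS : D ⊆ insert v S := by
      intro w hw
      obtain ⟨p, hp, rfl⟩ := Finset.mem_image.mp hw
      exact hbS p hp
    have hvD : v ∈ D := by
      obtain ⟨p, hp, rfl⟩ := hbv
      exact Finset.mem_image_of_mem _ hp
    -- A coloring in `C b` is prescribed by `b` on `D`, so it is determined by its restriction to
    -- `R`. As `|R| = |S| + 1 - |b|`, the growth hypothesis bounds `C b` by `β ^ (|b| - 1) g`.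
    set R := insert v S \ D with hR
    have hRS : R ⊆ S := by
      intro w hw
      rw [hR, Finset.mem_sdiff, Finset.mem_insert] at hw
      exact hw.1.resolve_left fun h => hw.2 (h ▸ hvD)
    have hRc : R.card + b.card = S.card + 1 := by
      rw [← hDc, hR, Finset.card_sdiff_add_card_eq_card hDS, Finset.card_insert_of_notMem hv]
    have h1 : (C b).ncard ≤ (avoiding a₀ E R).ncard := by
      refine Set.ncard_le_ncard_of_injOn (fun f w => if w ∈ R then f w else a₀) ?_ ?_
        (avoiding_finite a₀ E R)
      · rintro f ⟨hf, -⟩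
        refine ⟨fun w hw => if_neg hw, fun c hc hcR hm =>
          hf.2 c hc (fun p hp => hRS (hcR p hp)) (hm.congr fun p hp => if_pos (hcR p hp))⟩
      · rintro f ⟨hf, hfm, -⟩ f' ⟨hf', hfm', -⟩ h
        funext w
        by_cases hwR : w ∈ R
        · simpa [hwR] using congrFun h w
        by_cases hwS : w ∈ insert v S
        · have hwD : w ∈ D := by
            by_contra hwD
            exact hwR (Finset.mem_sdiff.mpr ⟨hwS, hwD⟩)
          obtain ⟨p, hp, rfl⟩ := Finset.mem_image.mp hwD
          rw [hfm p hp, hfm' p hp]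
        · rw [hf.1 w hwS, hf'.1 w hwS]
    have hbpos : 0 < b.card := by
      obtain ⟨p, hp, -⟩ := hbv
      exact Finset.card_pos.mpr ⟨p, hp⟩
    have h2 : S.card - R.card = b.card - 1 := by omega
    calc ((C b).ncard : ℝ) ≤ (avoiding a₀ E R).ncard := by exact_mod_cast h1
      _ ≤ β ^ (b.card - 1) * g := by rw [← h2]; exact hS R hRS
      _ = β⁻¹ * g * β ^ b.card := by
        obtain ⟨m, hm⟩ : ∃ m, b.card = m + 1 := ⟨b.card - 1, by omega⟩
        rw [hm, Nat.add_sub_cancel, pow_succ]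
        field_simp
  have hbound : (X.ncard : ℝ) ≤ (avoiding a₀ E (insert v S)).ncard + ∑ b ∈ N, ((C b).ncard : ℝ) := by
    have hCfin : (⋃ b ∈ N, C b).Finite :=
      N.finite_toSet.biUnion fun b _ => hXfin.subset fun _ hf => hf.1
    have h1 := Set.ncard_le_ncard hcover ((avoiding_finite a₀ E _).union hCfin)
    have h2 := Set.ncard_union_le (avoiding a₀ E (insert v S)) (⋃ b ∈ N, C b)
    have h3 := Finset.set_ncard_biUnion_le N C
    exact_mod_cast h1.trans (h2.trans (Nat.add_le_add_left h3 _))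
  have hsum' : ∑ b ∈ N, ((C b).ncard : ℝ) ≤ β⁻¹ * g * (Fintype.card A * β - 1) := by
    refine (Finset.sum_le_sum hC).trans ?_
    rw [← Finset.mul_sum]
    exact mul_le_mul_of_nonneg_left hsum (by positivity)
  -- The budget `|A| β - 1` is exactly what makes `|A| g` minus the losses equal to `β⁻¹ g`.
  have hfin : β⁻¹ * g ≤ (avoiding a₀ E (insert v S)).ncard := by
    have : β⁻¹ * g * (Fintype.card A * β - 1) = Fintype.card A * g - β⁻¹ * g := by
      field_simp
    linarith
  calc g = β * (β⁻¹ * g) := by field_simp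
    _ ≤ _ := mul_le_mul_of_nonneg_left hfin hβ.le

/-- If the forbidden partial colorings through each vertex have small total weight, then there are
at least `β⁻¹ ^ |S|` avoiding colorings of a finite set `S`. -/
theorem one_le_pow_mul_ncard_avoiding {V A : Type*} [DecidableEq V] [Fintype A] (a₀ : A)
    (E : Set (Finset (V × A))) {β : ℝ} (hβ : 0 < β) (hE : ∅ ∉ E)
    (hN : ∀ v, ∃ N : Finset (Finset (V × A)), (∀ b ∈ E, (∃ p ∈ b, p.1 = v) → b ∈ N) ∧
      ∑ b ∈ N, β ^ b.card ≤ Fintype.card A * β - 1) (S : Finset V) :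
    1 ≤ β ^ S.card * (avoiding a₀ E S).ncard := by
  -- The one-vertex step compares `S` with arbitrary subsets, so growth from every `R ⊆ S` is
  -- carried through the induction.
  have key : ∀ n, ∀ S : Finset V, S.card = n → ∀ R ⊆ S,
      ((avoiding a₀ E R).ncard : ℝ) ≤ β ^ (S.card - R.card) * (avoiding a₀ E S).ncard := by
    intro n
    induction n with
    | zero =>
      intro S hS R hR
      rw [Finset.card_eq_zero] at hS
      subst hS
      rw [Finset.subset_empty.mp hR]
      simp
    | succ n ih =>
      intro S hS R hR
      rcases eq_or_ne R S with rfl | hne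
      · simp
      obtain ⟨v, hvS, hvR⟩ := Finset.exists_of_ssubset (hR.ssubset_of_ne hne)
      have hc : (S.erase v).card = n := by rw [Finset.card_erase_of_mem hvS, hS]; rfl
      have hRe : R ⊆ S.erase v := Finset.subset_erase.mpr ⟨hR, hvR⟩
      obtain ⟨N, hN1, hN2⟩ := hN v
      have h1 := ncard_avoiding_insert a₀ E hβ (S.erase v) v (Finset.notMem_erase v S) N hN1 hN2
        (ih _ hc)
      rw [Finset.insert_erase hvS] at h1
      have h2 := ih _ hc R hRe
      have hle := Finset.card_le_card hRe
      have h3 : S.card - R.card = ((S.erase v).card - R.card) + 1 := by omega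
      rw [h3, pow_succ, mul_assoc]
      exact h2.trans (mul_le_mul_of_nonneg_left h1 (by positivity))
  have h0 : (avoiding a₀ E ∅).ncard = 1 := by
    rw [Set.ncard_eq_one]
    refine ⟨fun _ => a₀, Set.eq_singleton_iff_unique_mem.mpr ⟨⟨fun _ _ => rfl, ?_⟩, ?_⟩⟩
    · intro b hb hb'
      obtain rfl : b = ∅ := Finset.eq_empty_of_forall_notMem fun p hp => by simpa using hb' p hp
      exact (hE hb).elim
    · intro f hf
      funext v
      exact hf.1 v (Finset.notMem_empty v)
  have := key _ S rfl ∅ (Finset.empty_subset S)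
  simpa [h0] using this

/-! ### Counting for patterns placed along a pseudo-action -/

theorem sum_image_le_sum {ι κ : Type*} [DecidableEq κ] (s : Finset ι) (f : ι → κ) (g : κ → ℝ)
    (hg : ∀ b, 0 ≤ g b) : ∑ b ∈ s.image f, g b ≤ ∑ a ∈ s, g (f a) := by
  classical
  induction s using Finset.induction_on with
  | empty => simp
  | insert a s ha ih =>
    rw [Finset.image_insert, Finset.sum_insert ha]
    by_cases h : f a ∈ s.image f
    · rw [Finset.insert_eq_of_mem h]
      linarith [hg (f a)]
    · rw [Finset.sum_insert h]
      linarith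

open Classical in
/-- The partial coloring of `V` obtained by reading `P` along the pseudo-orbit of `u`. -/
def place {Γ V A : Type*} (α : Γ → V → V) (u : V) (P : Finset (Γ × A)) : Finset (V × A) :=
  P.image fun p => (α p.1 u, p.2)

theorem matches_place {Γ V A : Type*} {α : Γ → V → V} {u : V} {P : Finset (Γ × A)} {f : V → A} :
    Matches (place α u P) f ↔ Matches P (fun γ => f (α γ u)) := by
  classical
  simp only [Matches, place, Finset.forall_mem_image]

theorem mem_place {Γ V A : Type*} {α : Γ → V → V} {u : V} {P : Finset (Γ × A)} {p : V × A} :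
    p ∈ place α u P ↔ ∃ r ∈ P, (α r.1 u, r.2) = p := by
  classical
  simp only [place, Finset.mem_image]

theorem card_place {Γ V A : Type*} {α : Γ → V → V} {u : V} {P : Finset (Γ × A)} {T : Set Γ}
    (hP : ∀ p ∈ P, p.1 ∈ T) (hT : Set.InjOn (fun γ => α γ u) T) : (place α u P).card = P.card := by
  classical
  refine Finset.card_image_of_injOn fun p hp q hq h => ?_
  obtain ⟨h1, h2⟩ := Prod.mk.inj h
  exact Prod.ext (hT (hP p hp) (hP q hq) h1) h2

/-- By injectivity of `α γ` on `G`, a placement of `P` through `v` is determined by the cell of `P`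
that lands on `v`. So at most `|P|` placements of `P` meet `v`, whence the factor `P.card` in the
weight; injectivity along orbits keeps their size equal to `|P|`. -/
theorem one_le_pow_mul_ncard_avoiding_place {Γ V A : Type*} [Fintype A]
    (a₀ : A) (α : Γ → V → V) {β : ℝ} (hβ : 0 < β) (J : Finset (Finset (Γ × A))) (hJ : ∅ ∉ J)
    (hsum : ∑ P ∈ J, P.card * β ^ P.card ≤ Fintype.card A * β - 1)
    (T : Set Γ) (hT : ∀ P ∈ J, ∀ p ∈ P, p.1 ∈ T) (G : Set V)
    (h1 : ∀ u ∈ G, Set.InjOn (fun γ => α γ u) T) (h2 : ∀ γ ∈ T, Set.InjOn (α γ) G)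
    (S : Finset V) :
    1 ≤ β ^ S.card * (avoiding a₀ {b | ∃ P ∈ J, ∃ u ∈ G, b = place α u P} S).ncard := by
  classical
  refine one_le_pow_mul_ncard_avoiding a₀ _ hβ ?_ (fun v => ?_) S
  · rintro ⟨P, hP, u, -, h⟩
    rw [eq_comm, place, Finset.image_eq_empty] at h
    exact hJ (h ▸ hP)
  let I : Finset (Σ _ : Finset (Γ × A), Γ × A) :=
    (J.sigma fun P => P).filter fun q => ∃ u ∈ G, α q.2.1 u = v
  let F : (Σ _ : Finset (Γ × A), Γ × A) → Finset (V × A) := fun q =>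
    if h : ∃ u ∈ G, α q.2.1 u = v then place α h.choose q.1 else ∅
  refine ⟨I.image F, ?_, ?_⟩
  · rintro b ⟨P, hP, u, hu, rfl⟩ ⟨p, hp, rfl⟩
    obtain ⟨q, hq, rfl⟩ := Finset.mem_image.mp hp
    have hex : ∃ u' ∈ G, α q.1 u' = α q.1 u := ⟨u, hu, rfl⟩
    refine Finset.mem_image.mpr ⟨⟨P, q⟩, ?_, ?_⟩
    · exact Finset.mem_filter.mpr ⟨Finset.mem_sigma.mpr ⟨hP, hq⟩, hex⟩
    · have : F ⟨P, q⟩ = place α hex.choose P := dif_pos hex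
      rw [this, h2 q.1 (hT P hP q hq) hex.choose_spec.1 hu hex.choose_spec.2]
  · calc ∑ b ∈ I.image F, β ^ b.card ≤ ∑ q ∈ I, β ^ (F q).card :=
          sum_image_le_sum I F _ fun b => by positivity
      _ = ∑ q ∈ I, β ^ q.1.card := by
          refine Finset.sum_congr rfl fun q hq => ?_
          obtain ⟨hq1, hex⟩ := Finset.mem_filter.mp hq
          have : F q = place α hex.choose q.1 := dif_pos hex
          rw [this, card_place (hT q.1 (Finset.mem_sigma.mp hq1).1) (h1 _ hex.choose_spec.1)]
      _ ≤ ∑ q ∈ J.sigma fun P => P, β ^ q.1.card :=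
          Finset.sum_le_sum_of_subset_of_nonneg (Finset.filter_subset _ _)
            fun q _ _ => by positivity
      _ = ∑ P ∈ J, P.card * β ^ P.card := by
          rw [Finset.sum_sigma]
          exact Finset.sum_congr rfl fun P _ => by simp
      _ ≤ _ := hsum

/-! ### Amplification: enforcing a demand at small weight -/

theorem exists_mul_right_disjoint {Γ : Type*} [Group Γ] [Infinite Γ] (D E : Finset Γ) :
    ∃ δ : Γ, ∀ a ∈ D, a * δ ∉ E := by
  classical
  obtain ⟨δ, hδ⟩ := Infinite.exists_notMem_finset (Finset.image₂ (fun a b => a⁻¹ * b) D E)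
  refine ⟨δ, fun a ha h => hδ ?_⟩
  exact Finset.mem_image₂.mpr ⟨a, ha, a * δ, h, by simp⟩

/-- The collection `C` contains families of patterns of total weight bounded away from `1` and of
bounded size, supported off any prescribed finite set. -/
def IsAmplifiable {Γ A : Type*} (β : ℝ) (C : Set (Finset (Finset (Γ × A)))) : Prop :=
  ∃ (q : ℝ) (M : ℕ), q < 1 ∧ ∀ D : Finset Γ, ∃ Φ ∈ C, ∑ P ∈ Φ, β ^ P.card ≤ q ∧
    ∀ P ∈ Φ, P.card ≤ M ∧ ∀ p ∈ P, p.1 ∉ D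

/-- Avoiding some member of an amplifiable collection can be enforced by a family of patterns of
arbitrarily small weight. -/
theorem IsAmplifiable.exists_light {Γ A : Type*} {β : ℝ} (hβ : 0 < β)
    {C : Set (Finset (Finset (Γ × A)))} (hC : IsAmplifiable β C) {η : ℝ} (hη : 0 < η) :
    ∃ Ψ : Finset (Finset (Γ × A)), ∅ ∉ Ψ ∧ ∑ P ∈ Ψ, P.card * β ^ P.card ≤ η ∧
      ∀ x : Γ → A, (∀ P ∈ Ψ, ¬ Matches P x) → ∃ Φ ∈ C, ∀ P ∈ Φ, ¬ Matches P x := by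
  classical
  obtain ⟨q, M, hq1, hC⟩ := hC
  have hq0 : 0 ≤ q := by
    obtain ⟨Φ, -, h, -⟩ := hC ∅
    exact (Finset.sum_nonneg fun P _ => by positivity).trans h
  have key : ∀ n : ℕ, ∃ Ψ : Finset (Finset (Γ × A)), ∑ P ∈ Ψ, β ^ P.card ≤ q ^ n ∧
      (∀ P ∈ Ψ, P.card ≤ n * M) ∧
      ∀ x : Γ → A, (∀ P ∈ Ψ, ¬ Matches P x) → ∃ Φ ∈ C, ∀ P ∈ Φ, ¬ Matches P x := by
    intro n
    induction n with
    | zero =>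
      -- The empty pattern has weight `1` and matches everything, so the implication is vacuous.
      refine ⟨{∅}, by simp, by simp, fun x hx => ?_⟩
      exact (hx ∅ (Finset.mem_singleton_self _) fun p hp => by simp at hp).elim
    | succ n ih =>
      obtain ⟨Ψ, hw, hc, hx⟩ := ih
      -- Choosing `Φ` off the support of `Ψ` makes sizes of unions add, so weights multiply.
      obtain ⟨Φ, hΦC, hΦw, hΦ⟩ := hC ((Ψ.sup id).image Prod.fst)
      have hfc : ∀ r ∈ Ψ ×ˢ Φ, (r.1 ∪ r.2).card = r.1.card + r.2.card := by
        rintro ⟨P, Q⟩ hr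
        obtain ⟨hP, hQ⟩ := Finset.mem_product.mp hr
        refine Finset.card_union_of_disjoint (Finset.disjoint_right.mpr fun p hp hpP => ?_)
        exact (hΦ Q hQ).2 p hp (Finset.mem_image_of_mem _ (Finset.mem_sup.mpr ⟨P, hP, hpP⟩))
      refine ⟨(Ψ ×ˢ Φ).image fun r => r.1 ∪ r.2, ?_, ?_, ?_⟩
      · calc ∑ P ∈ (Ψ ×ˢ Φ).image fun r => r.1 ∪ r.2, β ^ P.card
            ≤ ∑ r ∈ Ψ ×ˢ Φ, β ^ (r.1 ∪ r.2).card :=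
              sum_image_le_sum _ _ _ fun b => by positivity
          _ = ∑ r ∈ Ψ ×ˢ Φ, β ^ r.1.card * β ^ r.2.card :=
              Finset.sum_congr rfl fun r hr => by rw [hfc r hr, pow_add]
          _ = (∑ P ∈ Ψ, β ^ P.card) * ∑ P ∈ Φ, β ^ P.card := by
              rw [Finset.sum_product, Finset.sum_mul_sum]
          _ ≤ q ^ (n + 1) := by
              rw [pow_succ]
              exact mul_le_mul hw hΦw (Finset.sum_nonneg fun P _ => by positivity)
                (by positivity)
      · intro P hP
        obtain ⟨r, hr, rfl⟩ := Finset.mem_image.mp hP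
        rw [hfc r hr, add_mul, one_mul]
        obtain ⟨hr1, hr2⟩ := Finset.mem_product.mp hr
        exact add_le_add (hc _ hr1) (hΦ _ hr2).1
      · intro x hxf
        by_cases h : ∀ P ∈ Ψ, ¬ Matches P x
        · exact hx x h
        · push Not at h
          obtain ⟨P, hP, hPx⟩ := h
          refine ⟨Φ, hΦC, fun Q hQ hQx => hxf (P ∪ Q)
            (Finset.mem_image.mpr ⟨(P, Q), Finset.mem_product.mpr ⟨hP, hQ⟩, rfl⟩) fun p hp => ?_⟩
          exact (Finset.mem_union.mp hp).elim (hPx p) (hQx p)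
  have hlim : Tendsto (fun n : ℕ => (n * q ^ n) * M) atTop (𝓝 0) := by
    simpa using (tendsto_self_mul_const_pow_of_lt_one hq0 hq1).mul_const (M : ℝ)
  -- The condition `n ≥ 1` gives `q ^ n < 1`, which excludes the empty pattern, of weight `1`, from
  -- `Ψ`.
  obtain ⟨n, hn, hn1⟩ := ((hlim.eventually_lt_const hη).and (eventually_ge_atTop 1)).exists
  obtain ⟨Ψ, hw, hc, hx⟩ := key n
  refine ⟨Ψ, fun h => ?_, ?_, hx⟩
  · have h1 : β ^ (∅ : Finset (Γ × A)).card ≤ ∑ P ∈ Ψ, β ^ P.card :=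
      Finset.single_le_sum (f := fun P : Finset (Γ × A) => β ^ P.card)
        (fun P _ => by positivity) h
    have h2 : q ^ n < 1 := pow_lt_one₀ hq0 hq1 (by omega)
    rw [Finset.card_empty, pow_zero] at h1
    linarith
  · calc ∑ P ∈ Ψ, P.card * β ^ P.card ≤ ∑ P ∈ Ψ, (n * M : ℝ) * β ^ P.card :=
          Finset.sum_le_sum fun P hP => mul_le_mul_of_nonneg_right
            (by exact_mod_cast hc P hP) (by positivity)
      _ = (n * M : ℝ) * ∑ P ∈ Ψ, β ^ P.card := by rw [Finset.mul_sum]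
      _ ≤ (n * M : ℝ) * q ^ n := mul_le_mul_of_nonneg_left hw (by positivity)
      _ ≤ η := by rw [show (n * M : ℝ) * q ^ n = n * q ^ n * M by ring]; exact hn.le

theorem isAmplifiable_translates {Γ A : Type*} [Group Γ] [Infinite Γ] {β : ℝ}
    (Φ : Finset (Finset (Γ × A))) (hβ : 0 < β) (hΦ : ∑ P ∈ Φ, β ^ P.card < 1) :
    IsAmplifiable β (Set.range fun δ : Γ =>
      open Classical in Φ.image (place (fun a b => a * b) δ)) := by
  classical
  refine ⟨_, Φ.sup Finset.card, hΦ, fun D => ?_⟩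
  obtain ⟨δ, hδ⟩ := exists_mul_right_disjoint ((Φ.sup id).image Prod.fst) D
  have hcard : ∀ P : Finset (Γ × A), (place (fun a b : Γ => a * b) δ P).card = P.card :=
    fun P => card_place (T := Set.univ) (fun _ _ => trivial)
      (fun a _ b _ h => mul_right_cancel h)
  refine ⟨_, ⟨δ, rfl⟩, ?_, Finset.forall_mem_image.mpr fun P hP => ⟨?_, fun p hp => ?_⟩⟩
  · refine (sum_image_le_sum _ _ _ fun P => by positivity).trans_eq ?_
    simp only [hcard]
  · rw [hcard]
    exact Finset.le_sup (f := Finset.card) hP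
  · obtain ⟨r, hr, rfl⟩ := mem_place.mp hp
    exact hδ r.1 (Finset.mem_image_of_mem _ (Finset.mem_sup.mpr ⟨P, hP, hr⟩))

open Classical in
/-- The patterns on `{δ, δ * γ}` with equal values at the two points. -/
def equalPatterns {Γ : Type*} (A : Type*) [Group Γ] [Fintype A] (γ δ : Γ) :
    Finset (Finset (Γ × A)) :=
  Finset.univ.image fun a => {(δ, a), (δ * γ, a)}

theorem isAmplifiable_equalPatterns {Γ A : Type*} [Group Γ] [Infinite Γ] [Fintype A] {β : ℝ}
    (hβ : 0 < β) (hβA : Fintype.card A * β ^ 2 < 1) {γ : Γ} (hγ : γ ≠ 1) :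
    IsAmplifiable β (Set.range (equalPatterns A γ)) := by
  classical
  refine ⟨_, 2, hβA, fun D => ?_⟩
  -- Avoiding both `D` and `D γ⁻¹` keeps `δ` and `δ * γ` out of `D`.
  obtain ⟨δ, hδ⟩ := Infinite.exists_notMem_finset (D ∪ D.image (· * γ⁻¹))
  rw [Finset.mem_union, not_or] at hδ
  have hcard : ∀ a : A, ({(δ, a), (δ * γ, a)} : Finset (Γ × A)).card = 2 := fun a =>
    Finset.card_pair fun h => hγ (left_eq_mul.mp (Prod.mk.inj h).1)
  refine ⟨_, ⟨δ, rfl⟩, ?_, Finset.forall_mem_image.mpr fun a _ => ⟨?_, fun p hp => ?_⟩⟩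
  · refine (sum_image_le_sum _ _ _ fun P => by positivity).trans_eq ?_
    simp [hcard]
  · exact (hcard a).le
  · rcases Finset.mem_insert.mp hp with rfl | hp
    · exact hδ.1
    · rw [Finset.mem_singleton.mp hp]
      exact fun h => hδ.2 (Finset.mem_image.mpr ⟨_, h, by simp⟩)

/-! ### Light sets of patterns meeting countably many demands -/

/-- A set of patterns of small total weight on every finite subset. -/
structure IsLight {Γ A : Type*} [Fintype A] (β : ℝ) (E : Set (Finset (Γ × A))) : Prop where
  empty_notMem : ∅ ∉ E
  sum_le : ∀ J : Finset (Finset (Γ × A)), (∀ P ∈ J, P ∈ E) →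
    ∑ P ∈ J, P.card * β ^ P.card ≤ Fintype.card A * β - 1

/-- Countably many amplifiable collections are taken care of by one light set of patterns. -/
theorem exists_isLight {ι Γ A : Type*} [Countable ι] [Fintype A] {β : ℝ}
    (hβ : 0 < β) (hβA : 1 < Fintype.card A * β) (C : ι → Set (Finset (Finset (Γ × A))))
    (hC : ∀ i, IsAmplifiable β (C i)) :
    ∃ E : Set (Finset (Γ × A)), IsLight β E ∧
      ∀ x : Γ → A, (∀ P ∈ E, ¬ Matches P x) → ∀ i, ∃ Φ ∈ C i, ∀ P ∈ Φ, ¬ Matches P x := by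
  classical
  have : Encodable ι := Encodable.ofCountable ι
  -- Split the positive budget `|A| β - 1` into positive shares, one for each collection.
  obtain ⟨η, hη, c, hc, hcle⟩ := posSumOfEncodable (sub_pos.mpr hβA) ι
  choose Ψ hΨ0 hΨw hΨx using fun i => (hC i).exists_light hβ (hη i)
  refine ⟨⋃ i, (Ψ i : Set (Finset (Γ × A))), ⟨by simpa using hΨ0, fun J hJ => ?_⟩,
    fun x hx i => hΨx i x fun P hP => hx P (Set.mem_iUnion.mpr ⟨_, hP⟩)⟩
  simp only [Set.mem_iUnion, Finset.mem_coe] at hJ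
  rcases J.eq_empty_or_nonempty with rfl | ⟨P₀, hP₀⟩
  · simpa using hβA.le
  have : Nonempty ι := (hJ P₀ hP₀).nonempty
  choose! φ hφ using hJ
  set I := (J.image φ).sigma Ψ
  have hsub : J ⊆ I.image fun q => q.2 := fun P hP => Finset.mem_image.mpr
    ⟨⟨φ P, P⟩, Finset.mem_sigma.mpr ⟨Finset.mem_image_of_mem _ hP, hφ P hP⟩, rfl⟩
  calc ∑ P ∈ J, P.card * β ^ P.card ≤ ∑ P ∈ I.image fun q => q.2, P.card * β ^ P.card :=
        Finset.sum_le_sum_of_subset_of_nonneg hsub fun P _ _ => by positivity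
    _ ≤ ∑ q ∈ I, q.2.card * β ^ q.2.card :=
        sum_image_le_sum I (fun q => q.2) (fun P => P.card * β ^ P.card)
          fun P => by positivity
    _ = ∑ i ∈ J.image φ, ∑ P ∈ Ψ i, P.card * β ^ P.card := Finset.sum_sigma _ _ _
    _ ≤ ∑ i ∈ J.image φ, η i := Finset.sum_le_sum fun i _ => hΨw i
    _ ≤ c := sum_le_hasSum _ (fun i _ => (hη i).le) hc
    _ ≤ _ := hcle

/-- One light set of patterns such that every configuration avoiding it has a translate avoiding
any given finite family of total weight `< 1`, and has no periods. -/
theorem exists_isLight_forall {Γ A : Type*} [Group Γ] [Infinite Γ] [Countable Γ] [Fintype A]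
    {β : ℝ} (hβ : 0 < β) (hβA : 1 < Fintype.card A * β) (hβA2 : Fintype.card A * β ^ 2 < 1) :
    ∃ E : Set (Finset (Γ × A)), IsLight β E ∧
      ∀ x : Γ → A, (∀ P ∈ E, ¬ Matches P x) →
        (∀ Φ : Finset (Finset (Γ × A)), ∑ P ∈ Φ, β ^ P.card < 1 →
          ∃ δ, ∀ P ∈ Φ, ¬ Matches P (shift δ x)) ∧
        ∀ γ : Γ, shift γ x = x → γ = 1 := by
  classical
  obtain ⟨E, hE, h⟩ := exists_isLight
    (ι := {Φ : Finset (Finset (Γ × A)) // ∑ P ∈ Φ, β ^ P.card < 1} ⊕ {γ : Γ // γ ≠ 1}) hβ hβA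
    (Sum.elim (fun Φ => Set.range fun δ : Γ => Φ.1.image (place (fun a b => a * b) δ))
      fun γ => Set.range (equalPatterns A γ.1))
    (by
      rintro (Φ | γ)
      · exact isAmplifiable_translates Φ.1 hβ Φ.2
      · exact isAmplifiable_equalPatterns hβ hβA2 γ.2)
  refine ⟨E, hE, fun x hx => ⟨fun Φ hΦ => ?_, fun γ hγx => ?_⟩⟩
  · obtain ⟨_, ⟨δ, rfl⟩, hδ⟩ := h x hx (Sum.inl ⟨Φ, hΦ⟩)
    exact ⟨δ, fun P hP hm => hδ _ (Finset.mem_image_of_mem _ hP) (matches_place.mpr hm)⟩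
  · by_contra hγ
    obtain ⟨_, ⟨δ, rfl⟩, hδ⟩ := h x hx (Sum.inr ⟨γ, hγ⟩)
    refine hδ _ (Finset.mem_image_of_mem _ (Finset.mem_univ (x δ))) fun p hp => ?_
    rcases Finset.mem_insert.mp hp with rfl | hp
    · rfl
    · rw [Finset.mem_singleton.mp hp]
      exact congrFun hγx δ

/-! ### Subshifts given by forbidden patterns, and compactness -/

/-- The set of configurations none of whose translates matches a pattern in `E`. -/
def forbid {Γ A : Type*} [Group Γ] (E : Set (Finset (Γ × A))) : Set (Γ → A) :=
  {x | ∀ P ∈ E, ∀ g, ¬ Matches P (shift g x)}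

/-- The configurations avoiding those translated patterns in `E` that are listed in `J`. -/
def forbidOn {Γ A : Type*} [Group Γ] (E : Set (Finset (Γ × A)))
    (J : Finset (Finset (Γ × A) × Γ)) : Set (Γ → A) :=
  {x | ∀ q ∈ J, q.1 ∈ E → ¬ Matches q.1 (shift q.2 x)}

theorem forbid_eq_iInter {Γ A : Type*} [Group Γ] (E : Set (Finset (Γ × A))) :
    forbid E = ⋂ J, forbidOn E J := by
  ext x
  simp only [forbid, forbidOn, Set.mem_iInter, Set.mem_ofPred_eq]
  exact ⟨fun h J q _ hq => h q.1 hq q.2, fun h P hP g =>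
    h {(P, g)} (P, g) (Finset.mem_singleton_self _) hP⟩

theorem isOpen_matches {Γ : Type*} {k : ℕ} (P : Finset (Γ × Fin k)) :
    IsOpen {x : Γ → Fin k | Matches P x} := by
  have : {x : Γ → Fin k | Matches P x} = ⋂ p ∈ P, (fun x => x p.1) ⁻¹' {p.2} := by
    ext x; simp [Matches]
  rw [this]
  exact isOpen_biInter_finset fun p _ => (isOpen_discrete _).preimage (continuous_apply _)

theorem continuous_shift {Γ : Type*} [Group Γ] {k : ℕ} (g : Γ) :
    Continuous (shift g : (Γ → Fin k) → Γ → Fin k) :=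
  continuous_pi fun δ => continuous_apply (δ * g)

theorem isClosed_forbidOn {Γ : Type*} [Group Γ] {k : ℕ} (E : Set (Finset (Γ × Fin k)))
    (J : Finset (Finset (Γ × Fin k) × Γ)) : IsClosed (forbidOn E J) := by
  have : forbidOn E J =
      ⋂ q ∈ J, ⋂ _ : q.1 ∈ E, (shift q.2 ⁻¹' {x : Γ → Fin k | Matches q.1 x})ᶜ := by
    ext x; simp [forbidOn]
  rw [this]
  exact isClosed_biInter fun q _ => isClosed_iInter fun _ =>
    ((isOpen_matches q.1).preimage (continuous_shift q.2)).isClosed_compl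

theorem isSubshift_forbid {Γ : Type*} [Group Γ] {k : ℕ} (E : Set (Finset (Γ × Fin k))) :
    IsSubshift (forbid E) where
  isClosed := by
    rw [forbid_eq_iInter]
    exact isClosed_iInter fun J => isClosed_forbidOn E J
  invariant := fun γ x hx P hP g => by
    rw [← shift_mul]
    exact hx P hP (g * γ)

theorem inter_forbid_nonempty {Γ : Type*} [Group Γ] {k : ℕ} (E : Set (Finset (Γ × Fin k)))
    {C : Set (Γ → Fin k)} (hC : IsClosed C) (h : ∀ J, (C ∩ forbidOn E J).Nonempty) :
    (C ∩ forbid E).Nonempty := by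
  classical
  rw [forbid_eq_iInter, Set.inter_iInter]
  have hcl : ∀ J, IsClosed (C ∩ forbidOn E J) := fun J => hC.inter (isClosed_forbidOn E J)
  refine IsCompact.nonempty_iInter_of_directed_nonempty_isCompact_isClosed _ ?_ h
    (fun J => (hcl J).isCompact) hcl
  intro J J'
  refine ⟨J ∪ J', fun x hx => ⟨hx.1, fun q hq => hx.2 q (Finset.mem_union_left _ hq)⟩,
    fun x hx => ⟨hx.1, fun q hq => hx.2 q (Finset.mem_union_right _ hq)⟩⟩

theorem IsLight.forbid_nonempty {Γ : Type*} [Group Γ] {k : ℕ} [NeZero k] {β : ℝ} (hβ : 0 < β)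
    {E : Set (Finset (Γ × Fin k))} (hE : IsLight β E) : (forbid E).Nonempty := by
  classical
  have := inter_forbid_nonempty E isClosed_univ fun J => ?_
  · rwa [Set.univ_inter] at this
  rw [Set.univ_inter]
  set J' := (J.image Prod.fst).filter (· ∈ E)
  have hJE : ∀ P ∈ J', P ∈ E := fun P hP => (Finset.mem_filter.mp hP).2
  -- The finitely many cells read by the listed translates; an avoiding coloring of `S` handles them
  -- all.
  let S : Finset Γ := J.biUnion fun q => q.1.image fun p => p.1 * q.2
  have hcount := one_le_pow_mul_ncard_avoiding_place (0 : Fin k) (fun a b : Γ => a * b) hβ J'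
    (fun h => hE.empty_notMem (hJE _ h)) (hE.sum_le J' hJE) Set.univ (fun _ _ _ _ => trivial)
    Set.univ (fun u _ a _ b _ h => mul_right_cancel h) (fun γ _ a _ b _ h => mul_left_cancel h) S
  have hne : (avoiding (0 : Fin k)
      {b | ∃ P ∈ J', ∃ u ∈ Set.univ, b = place (fun a b : Γ => a * b) u P} S).Nonempty := by
    refine Set.nonempty_of_ncard_ne_zero fun h => ?_
    rw [h] at hcount
    norm_num at hcount
  obtain ⟨f, hf⟩ := hne
  refine ⟨f, fun q hq hqE hm => hf.2 (place (fun a b => a * b) q.2 q.1)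
    ⟨q.1, Finset.mem_filter.mpr ⟨Finset.mem_image_of_mem _ hq, hqE⟩, q.2, trivial, rfl⟩ ?_ ?_⟩
  · intro p hp
    obtain ⟨r, hr, rfl⟩ := mem_place.mp hp
    exact Finset.mem_biUnion.mpr ⟨q, hq, Finset.mem_image_of_mem _ hr⟩
  · exact matches_place.mpr hm

/-! ### Sofic entropy -/

/-- For a sufficiently faithful pseudo-action there are at least `β⁻¹ ^ |V|` approximate
colorings. -/
theorem IsLight.exists_faithful_bound {Γ : Type*} [Group Γ] {k : ℕ} [NeZero k] {β : ℝ}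
    (hβ : 0 < β) {E : Set (Finset (Γ × Fin k))} (hE : IsLight β E) (F : Finset Γ) :
    ∃ L : Finset Γ, ∀ (V : Type) [Finite V] (α : Γ → V → V) (ε : ℝ), IsFaithful α ε (L : Set Γ) →
      1 ≤ β ^ Nat.card V * (approxColorings ε F α (forbid E)).ncard := by
  classical
  -- By compactness, avoiding finitely many translated patterns already forces the restriction to
  -- `F` into `patterns (forbid E) F`.
  obtain ⟨J, hJ⟩ : ∃ J, ∀ x ∈ forbidOn E J, F.restrict x ∈ patterns (forbid E) F := by
    by_contra! hcon
    have hC : IsClosed {x : Γ → Fin k | F.restrict x ∉ patterns (forbid E) F} := by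
      refine (isClosed_discrete (patterns (forbid E) F)ᶜ).preimage ?_
      exact continuous_pi fun s => continuous_apply s.1
    obtain ⟨x, hx1, hx2⟩ := inter_forbid_nonempty E hC fun J => by
      obtain ⟨x, hx, hx'⟩ := hcon J
      exact ⟨x, hx', hx⟩
    exact hx1 ⟨x, hx2, rfl⟩
  set J' := (J.image Prod.fst).filter (· ∈ E)
  have hJE : ∀ P ∈ J', P ∈ E := fun P hP => (Finset.mem_filter.mp hP).2
  set T : Finset Γ := J'.biUnion fun P => P.image Prod.fst
  set H : Finset Γ := J.image Prod.snd with hH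
  set L : Finset Γ := T ∪ T.image (fun γ => γ⁻¹) ∪ H ∪ Finset.image₂ (fun a b => a * b) T H with hL
  have hLT : ∀ γ ∈ T, γ ∈ L := fun γ h => by simp [hL, h]
  have hLT' : ∀ γ ∈ T, γ⁻¹ ∈ L := fun γ h => by simp [hL, h]
  have hLH : ∀ γ ∈ H, γ ∈ L := fun γ h => by simp [hL, h]
  have hLTH : ∀ γ ∈ T, ∀ g ∈ H, γ * g ∈ L := fun γ h g hg =>
    Finset.mem_union_right _ (Finset.mem_image₂_of_mem h hg)
  have hT : ∀ P ∈ J', ∀ p ∈ P, p.1 ∈ T := fun P hP p hp =>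
    Finset.mem_biUnion.mpr ⟨P, hP, Finset.mem_image_of_mem _ hp⟩
  refine ⟨L, fun V _ α ε hα => ?_⟩
  have := Fintype.ofFinite V
  -- Patterns are placed only at points `α g v` with `v` proper and `g ∈ H`. This suffices for the
  -- windows read from proper points, and properness supplies both injectivity conditions there.
  let G : Set V := {u | ∃ v, IsProper α (L : Set Γ) v ∧ ∃ g ∈ H, u = α g v}
  have hcount := one_le_pow_mul_ncard_avoiding_place (0 : Fin k) α hβ J'
    (fun h => hE.empty_notMem (hJE _ h)) (hE.sum_le J' hJE) (T : Set Γ) hT G ?_ ?_ Finset.univ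
  · rw [Finset.card_univ, ← Nat.card_eq_fintype_card] at hcount
    refine hcount.trans (mul_le_mul_of_nonneg_left ?_ (by positivity))
    have hsub : avoiding (0 : Fin k) {b | ∃ P ∈ J', ∃ u ∈ G, b = place α u P} Finset.univ ⊆
        approxColorings ε F α (forbid E) := by
      intro f hf
      refine le_trans hα (Nat.cast_le.mpr (Set.ncard_le_ncard (fun v hv => hJ _ ?_)
        (Set.toFinite _)))
      intro q hq hqE hm
      have hq' : q.1 ∈ J' := Finset.mem_filter.mpr ⟨Finset.mem_image_of_mem _ hq, hqE⟩
      have hqH : q.2 ∈ H := Finset.mem_image_of_mem _ hq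
      refine hf.2 (place α (α q.2 v) q.1) ⟨q.1, hq', _, ⟨v, hv, q.2, hqH, rfl⟩, rfl⟩
        (fun _ _ => Finset.mem_univ _) (matches_place.mpr fun p hp => ?_)
      have hpT := hT _ hq' p hp
      have h1 := hv.equivariance p.1 (hLT _ hpT) q.2 (hLH _ hqH) (hLTH _ hpT _ hqH)
      exact (congrArg f h1).trans (hm p hp)
    exact_mod_cast Set.ncard_le_ncard hsub (Set.toFinite _)
  · rintro u ⟨v, hv, g, hg, rfl⟩ γ hγ γ' hγ' h
    have e1 := hv.equivariance γ (hLT _ hγ) g (hLH _ hg) (hLTH _ hγ _ hg)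
    have e2 := hv.equivariance γ' (hLT _ hγ') g (hLH _ hg) (hLTH _ hγ' _ hg)
    have h' : α γ (α g v) = α γ' (α g v) := h
    rw [e1, e2] at h'
    exact mul_right_cancel (hv.freeness _ (hLTH _ hγ _ hg) _ (hLTH _ hγ' _ hg) h')
  · intro γ hγ
    -- Equivariance at `v`, with `γ⁻¹`, `γ * g` and `g` all in `L`, shows that `α γ⁻¹` undoes `α γ`
    -- on `G`.
    refine Set.LeftInvOn.injOn (f₁' := α γ⁻¹) ?_
    rintro u ⟨v, hv, g, hg, rfl⟩
    rw [hv.equivariance γ (hLT _ hγ) g (hLH _ hg) (hLTH _ hγ _ hg),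
      hv.equivariance γ⁻¹ (hLT' _ hγ) (γ * g) (hLTH _ hγ _ hg) (by simpa using hLH _ hg),
      inv_mul_cancel_left]

theorem logb_inv_le_logb_div {β : ℝ} (hβ : 0 < β) {n : ℕ} (hn : 0 < n) {N : ℕ}
    (h : 1 ≤ β ^ n * N) : Real.logb 2 β⁻¹ ≤ Real.logb 2 N / n := by
  have hn' : (0 : ℝ) < n := by exact_mod_cast hn
  rw [le_div_iff₀ hn', mul_comm, ← Real.logb_pow]
  refine Real.logb_le_logb_of_le (by norm_num) (by positivity) ?_
  rw [inv_pow]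
  exact (inv_le_iff_one_le_mul₀' (by positivity)).mpr h

theorem IsLight.le_soficEntropy {Γ : Type*} [Group Γ] {k : ℕ} [NeZero k] {β : ℝ}
    (hβ : 0 < β) {E : Set (Finset (Γ × Fin k))} (hE : IsLight β E) (S : SoficApproximation Γ) :
    ((Real.logb 2 β⁻¹ : ℝ) : EReal) ≤ soficEntropy (forbid E) S := by
  refine le_iInf₂ fun ε hε => le_iInf fun F => ?_
  obtain ⟨L, hL⟩ := hE.exists_faithful_bound hβ F
  refine le_limsup_of_frequently_le' ((S.faithful ε hε L).mono fun n hn => ?_).frequently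
  have := S.finite n
  have := S.nonempty n
  have h1 := hL (S.V n) (S.act n) ε hn
  have hne : approxColorings ε F (S.act n) (forbid E) ≠ ∅ := by
    intro h0
    rw [h0, Set.ncard_empty] at h1
    norm_num at h1
  rw [approxEntropy, if_neg hne]
  exact EReal.coe_le_coe_iff.mpr (logb_inv_le_logb_div hβ Nat.card_pos h1)

/-! ### Heavy covers, Følner entropy and Hausdorff dimension -/

/-- The pattern with support `S` and values `q`. -/
def graphPattern {Γ A : Type*} (S : Finset Γ) (q : S → A) : Finset (Γ × A) :=
  Finset.univ.map ⟨fun s : S => (s.1, q s), fun _ _ h => Subtype.ext (Prod.mk.inj h).1⟩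

theorem card_graphPattern {Γ A : Type*} (S : Finset Γ) (q : S → A) :
    (graphPattern S q).card = S.card := by
  simp [graphPattern]

theorem matches_graphPattern {Γ A : Type*} {S : Finset Γ} {q : S → A} {x : Γ → A} :
    Matches (graphPattern S q) x ↔ S.restrict x = q := by
  simp only [graphPattern, Matches, Finset.mem_map, Finset.mem_univ, true_and,
    forall_exists_index, funext_iff]
  exact ⟨fun h s => h _ s rfl, fun h p s hs => hs ▸ h s⟩

/-- Every finite family of patterns whose cylinders cover `Y` has total weight at least `1`. -/
def HasHeavyCovers {Γ A : Type*} (β : ℝ) (Y : Set (Γ → A)) : Prop :=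
  ∀ Φ : Finset (Finset (Γ × A)), (∀ x ∈ Y, ∃ P ∈ Φ, Matches P x) → 1 ≤ ∑ P ∈ Φ, β ^ P.card

/-- The patterns of `Y` on `F` themselves form a cover, each of weight `β ^ |F|`. -/
theorem HasHeavyCovers.one_le_pow_mul_ncard_patterns {Γ : Type*} {k : ℕ} {β : ℝ} (hβ : 0 < β)
    {Y : Set (Γ → Fin k)} (hY : HasHeavyCovers β Y) (F : Finset Γ) :
    1 ≤ β ^ F.card * (patterns Y F).ncard := by
  classical
  have hfin : (patterns Y F).Finite := Set.toFinite _
  refine (hY (hfin.toFinset.image (graphPattern F)) fun x hx => ?_).trans ?_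
  · exact ⟨graphPattern F (F.restrict x), Finset.mem_image_of_mem _
      (hfin.mem_toFinset.mpr ⟨x, hx, rfl⟩), matches_graphPattern.mpr rfl⟩
  · refine (sum_image_le_sum _ _ _ fun P => by positivity).trans ?_
    simp only [card_graphPattern, Finset.sum_const, nsmul_eq_mul]
    rw [Set.ncard_eq_toFinset_card _ hfin, mul_comm]

theorem HasHeavyCovers.le_folnerEntropy {Γ : Type*} [Group Γ] {k : ℕ} {β : ℝ} (hβ : 0 < β)
    {Y : Set (Γ → Fin k)} (hY : HasHeavyCovers β Y) {F : ℕ → Finset Γ} (hF : IsFolnerSeq F) :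
    ((Real.logb 2 β⁻¹ : ℝ) : EReal) ≤ folnerEntropy F Y := by
  refine le_liminf_of_le (by isBoundedDefault) (Eventually.of_forall fun n => ?_)
  exact EReal.coe_le_coe_iff.mpr (logb_inv_le_logb_div hβ (Finset.card_pos.mpr (hF.nonempty n))
    (hY.one_le_pow_mul_ncard_patterns hβ (F n)))

/-- Hausdorff measure is a supremum over scales, so the single scale `1` already shows it is
nonzero. -/
theorem le_dimH_of_forall_cover {X : Type*} [EMetricSpace X] (s : Set X) (d : NNReal)
    (h : ∀ t : ℕ → Set X, s ⊆ ⋃ n, t n →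
      1 ≤ ∑' n, ⨆ _ : (t n).Nonempty, Metric.ediam (t n) ^ (d : ℝ)) : (d : ℝ≥0∞) ≤ dimH s := by
  borelize X
  refine le_dimH_of_hausdorffMeasure_ne_zero (ne_of_gt (lt_of_lt_of_le one_pos ?_))
  rw [Measure.hausdorffMeasure_apply]
  exact le_iSup₂_of_le 1 one_pos (le_iInf fun t => le_iInf fun ht => le_iInf fun _ => h t ht)

/-- With `d = log₂ β⁻¹`, a cylinder on the first `m` coordinates has weight `β ^ m = (2 ^ (-m)) ^
d`. An arbitrary countable cover is replaced by such cylinders at small extra cost, and compactness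
makes it finite. -/
theorem HasHeavyCovers.le_hausdorffDim {Γ : Type*} {k : ℕ} {β : ℝ} (hβ : 0 < β)
    (hβ1 : β < 1) {Y : Set (Γ → Fin k)} (hYc : IsCompact Y) (hYne : Y.Nonempty)
    (hY : HasHeavyCovers β Y) (e : ℕ ≃ Γ) :
    ENNReal.ofReal (Real.logb 2 β⁻¹) ≤ hausdorffDim e Y := by
  classical
  set d := Real.logb 2 β⁻¹ with hd
  have hd0 : 0 ≤ d := Real.logb_nonneg (by norm_num) (one_le_inv_iff₀.mpr ⟨hβ, hβ1.le⟩)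
  have hpow : ∀ m : ℕ, ENNReal.ofReal ((1 / 2 : ℝ) ^ m) ^ d = ENNReal.ofReal (β ^ m) := by
    intro m
    rw [ENNReal.ofReal_rpow_of_nonneg (by positivity) hd0]
    congr 1
    have h2 : (2 : ℝ) ^ d = β⁻¹ := Real.rpow_logb (by norm_num) (by norm_num) (by positivity)
    rw [← Real.rpow_natCast (1 / 2 : ℝ) m, ← Real.rpow_mul (by norm_num), mul_comm,
      Real.rpow_mul (by norm_num), Real.rpow_natCast, one_div, Real.inv_rpow (by norm_num), h2,
      inv_inv]
  let _ : MetricSpace (Γ → Fin k) := enumMetric e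
  refine le_dimH_of_forall_cover (X := Γ → Fin k) Y d.toNNReal fun t ht => ?_
  rw [Real.coe_toNNReal d hd0]
  refine ENNReal.le_of_forall_pos_le_add fun η hη _ => ?_
  obtain ⟨η', hη'0, hη'⟩ := ENNReal.exists_pos_sum_of_countable
    (ENNReal.coe_ne_zero.mpr hη.ne') ℕ
  have hcyl : ∀ n, ∃ (y : Γ → Fin k) (m : ℕ), (∀ x ∈ t n, ∀ i < m, x (e i) = y (e i)) ∧
      ENNReal.ofReal (β ^ m) ≤ (⨆ _ : (t n).Nonempty, Metric.ediam (t n) ^ d) + η' n := by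
    intro n
    -- For an empty set or a singleton the diameter gives no weight, so a long cylinder is paid for
    -- by `η' n`.
    have hsmall : ∃ m : ℕ, ENNReal.ofReal (β ^ m) ≤ η' n := by
      obtain ⟨m, hm⟩ := exists_pow_lt_of_lt_one (show (0 : ℝ) < η' n from hη'0 n) hβ1
      refine ⟨m, ?_⟩
      rw [← ENNReal.ofReal_coe_nnreal]
      exact ENNReal.ofReal_le_ofReal hm.le
    rcases (t n).eq_empty_or_nonempty with h0 | ⟨y, hy⟩
    · obtain ⟨m, hm⟩ := hsmall
      obtain ⟨y, -⟩ := hYne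
      exact ⟨y, m, by simp [h0], hm.trans le_add_self⟩
    refine ⟨y, ?_⟩
    by_cases hall : ∀ m, ∀ x ∈ t n, ∀ i < m, x (e i) = y (e i)
    · obtain ⟨m, hm⟩ := hsmall
      exact ⟨m, hall m, hm.trans le_add_self⟩
    · have hex : ∃ m, ¬ ∀ x ∈ t n, ∀ i < m, x (e i) = y (e i) := not_forall.mp hall
      have hspec := Nat.find_spec hex
      have hM : Nat.find hex ≠ 0 := fun h => by
        rw [h] at hspec
        exact hspec fun x _ i hi => absurd hi (Nat.not_lt_zero i)
      obtain ⟨m, hm⟩ := Nat.exists_eq_succ_of_ne_zero hM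
      have hmall : ∀ x ∈ t n, ∀ i < m, x (e i) = y (e i) :=
        not_not.mp (Nat.find_min hex (by omega))
      rw [hm] at hspec
      push Not at hspec
      obtain ⟨x, hx, i, hi, hxi⟩ := hspec
      refine ⟨m, hmall, le_add_right ?_⟩
      rw [iSup_pos ⟨y, hy⟩, ← hpow]
      refine ENNReal.rpow_le_rpow (le_trans ?_ (Metric.edist_le_ediam_of_mem hx hy)) hd0
      rw [edist_dist]
      refine ENNReal.ofReal_le_ofReal ?_
      have hne : x ≠ y := fun h => hxi (by rw [h])
      have hdist := enumMetric_dist e hne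
      refine le_trans ?_ hdist.ge
      refine pow_le_pow_of_le_one (by norm_num) (by norm_num) ((Nat.sInf_le hxi).trans ?_)
      omega
  choose y m hym hw using hcyl
  let P : ℕ → Finset (Γ × Fin k) := fun n =>
    let S := (Finset.range (m n)).map e.toEmbedding
    graphPattern S (S.restrict (y n))
  have hPc : ∀ n, (P n).card = m n := fun n => by simp [P, card_graphPattern]
  have hPm : ∀ n, ∀ x ∈ t n, Matches (P n) x := by
    intro n x hx
    refine matches_graphPattern.mpr (funext fun s => ?_)
    obtain ⟨i, hi, his⟩ := Finset.mem_map.mp s.2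
    have := hym n x hx i (Finset.mem_range.mp hi)
    change x s.1 = y n s.1
    rw [← his]
    exact this
  obtain ⟨I, hI⟩ := hYc.elim_finite_subcover (fun n => {x : Γ → Fin k | Matches (P n) x})
    (fun n => isOpen_matches (P n)) fun x hx => by
      obtain ⟨n, hn⟩ := Set.mem_iUnion.mp (ht hx)
      exact Set.mem_iUnion.mpr ⟨n, hPm n x hn⟩
  have h1 : 1 ≤ ∑ n ∈ I, β ^ m n := by
    refine (hY (I.image P) fun x hx => ?_).trans ?_
    · obtain ⟨n, hn, hxn⟩ := Set.mem_iUnion₂.mp (hI hx)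
      exact ⟨P n, Finset.mem_image_of_mem _ hn, hxn⟩
    · refine (sum_image_le_sum _ _ _ fun P => by positivity).trans_eq ?_
      simp only [hPc]
  calc (1 : ℝ≥0∞) = ENNReal.ofReal 1 := ENNReal.ofReal_one.symm
    _ ≤ ENNReal.ofReal (∑ n ∈ I, β ^ m n) := ENNReal.ofReal_le_ofReal h1
    _ = ∑ n ∈ I, ENNReal.ofReal (β ^ m n) :=
        ENNReal.ofReal_sum_of_nonneg fun n _ => by positivity
    _ ≤ ∑ n ∈ I, ((⨆ _ : (t n).Nonempty, Metric.ediam (t n) ^ d) + η' n) :=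
        Finset.sum_le_sum fun n _ => hw n
    _ ≤ ∑' n, ((⨆ _ : (t n).Nonempty, Metric.ediam (t n) ^ d) + η' n) := ENNReal.sum_le_tsum I
    _ = ∑' n, (⨆ _ : (t n).Nonempty, Metric.ediam (t n) ^ d) + ∑' n, (η' n : ℝ≥0∞) :=
        ENNReal.tsum_add
    _ ≤ _ := add_le_add le_rfl hη'.le

/-! ### Minimal subsystems and avoidance of light families -/

theorem IsSubshift.exists_isMinimalSubshift {Γ : Type*} [Group Γ] {k : ℕ} {X : Set (Γ → Fin k)}
    (hX : IsSubshift X) (hne : X.Nonempty) : ∃ Y ⊆ X, IsMinimalSubshift Y := by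
  obtain ⟨Y, hYX, hY⟩ := zorn_superset_nonempty
    {Z : Set (Γ → Fin k) | IsSubshift Z ∧ Z.Nonempty} (fun c hc hchain hcne => by
      have : Nonempty c := hcne.to_subtype
      refine ⟨⋂₀ c, ⟨⟨isClosed_sInter fun Z hZ => (hc hZ).1.isClosed, ?_⟩, ?_⟩,
        fun Z hZ => Set.sInter_subset_of_mem hZ⟩
      · exact fun γ x hx Z hZ => (hc hZ).1.invariant γ x (hx Z hZ)
      · exact IsCompact.nonempty_sInter_of_directed_nonempty_isCompact_isClosed
          (fun Z hZ W hW => (hchain.total hZ hW).elim (fun h => ⟨Z, hZ, subset_rfl, h⟩)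
            fun h => ⟨W, hW, h, subset_rfl⟩) (fun Z hZ => (hc hZ).2)
          (fun Z hZ => (hc hZ).1.isClosed.isCompact) (fun Z hZ => (hc hZ).1.isClosed))
    X ⟨hX, hne⟩
  exact ⟨Y, hYX, hY.prop.1, hY.prop.2, fun Z hZ hZne hZY =>
    (hZY.antisymm (hY.le_of_le ⟨hZ, hZne⟩ hZY))⟩

/-- Every finite family of patterns of total weight `< 1` is avoided by a translate of each point
of `X`. -/
def AvoidsLightFamilies {Γ A : Type*} [Group Γ] (β : ℝ) (X : Set (Γ → A)) : Prop :=
  ∀ Φ : Finset (Finset (Γ × A)), ∑ P ∈ Φ, β ^ P.card < 1 →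
    ∀ x ∈ X, ∃ δ, ∀ P ∈ Φ, ¬ Matches P (shift δ x)

/-- A cover of weight `< 1` would miss a translate of a point of `Y`, yet that translate lies in
`Y`. This is why the bounds pass to every nonempty subsystem. -/
theorem AvoidsLightFamilies.hasHeavyCovers {Γ : Type*} [Group Γ] {k : ℕ} {β : ℝ}
    {X Y : Set (Γ → Fin k)} (hX : AvoidsLightFamilies β X) (hYX : Y ⊆ X) (hY : IsSubshift Y)
    (hne : Y.Nonempty) : HasHeavyCovers β Y := by
  intro Φ hΦ
  by_contra! hlt
  obtain ⟨x, hx⟩ := hne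
  obtain ⟨δ, hδ⟩ := hX Φ hlt x (hYX hx)
  obtain ⟨P, hP, hm⟩ := hΦ _ (hY.invariant δ x hx)
  exact hδ P hP hm

/-- The patterns on `S` other than `q` form a light family, so each orbit meets the cylinder of `q`
and hence `U`; invariance of `U` then returns to the original point. -/
theorem AvoidsLightFamilies.subset_of_isOpen {Γ : Type*} [Group Γ] {k : ℕ} {β : ℝ} (hβ : 0 < β)
    {X U : Set (Γ → Fin k)} (hX : AvoidsLightFamilies β X) (hU : ShiftInvariant U) {S : Finset Γ}
    {q : S → Fin k} (hq : ∀ x : Γ → Fin k, S.restrict x = q → x ∈ U)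
    (hkβ : ((k : ℝ) ^ S.card - 1) * β ^ S.card < 1) : X ⊆ U := by
  classical
  intro x hx
  obtain ⟨δ, hδ⟩ := hX ((Finset.univ.erase q).image (graphPattern S)) (by
    refine lt_of_le_of_lt (sum_image_le_sum _ _ _ fun P => by positivity) ?_
    simp only [card_graphPattern, Finset.sum_const, nsmul_eq_mul]
    rw [Finset.cast_card_erase_of_mem (Finset.mem_univ _)]
    simpa using hkβ) x hx
  have hmem : shift δ x ∈ U := by
    refine hq _ ?_
    by_contra hne
    exact hδ _ (Finset.mem_image_of_mem _ (Finset.mem_erase.mpr ⟨hne, Finset.mem_univ _⟩))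
      (matches_graphPattern.mpr rfl)
  have := hU δ⁻¹ _ hmem
  rwa [← shift_mul, inv_mul_cancel, shift_one] at this

end LargeSubshift

end

/-! ### Choice of `β` and conclusion -/

theorem theorem1 {Γ : Type*} [Group Γ] [Countable Γ] [Infinite Γ] (k : ℕ) (hk : 2 ≤ k)
    (U : Set (Γ → Fin k)) (hUne : U.Nonempty) (hUopen : IsOpen U)
    (hUinv : LargeSubshift.ShiftInvariant U) (h : ℝ) (hh : h < Real.logb 2 k) :
    (∃ X : Set (Γ → Fin k), LargeSubshift.IsMinimalSubshift X ∧ LargeSubshift.IsFree X ∧ X ⊆ U ∧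
      ∀ e : ℕ ≃ Γ, ENNReal.ofReal h ≤ LargeSubshift.hausdorffDim e X) ∧
    (LargeSubshift.IsAmenable Γ →
      ∃ X : Set (Γ → Fin k), LargeSubshift.IsMinimalSubshift X ∧ LargeSubshift.IsFree X ∧ X ⊆ U ∧
        ∀ F : ℕ → Finset Γ, LargeSubshift.IsFolnerSeq F →
          (h : EReal) ≤ LargeSubshift.folnerEntropy F X) ∧
    (LargeSubshift.IsSofic Γ →
      ∃ X : Set (Γ → Fin k), LargeSubshift.IsSubshift X ∧ X.Nonempty ∧ LargeSubshift.IsFree X ∧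
        X ⊆ U ∧
        ∀ S : LargeSubshift.SoficApproximation Γ, (h : EReal) ≤ LargeSubshift.soficEntropy X S) := by
  have : NeZero k := ⟨by omega⟩
  have hk0 : (0 : ℝ) < k := by exact_mod_cast (by omega : 0 < k)
  have hk1 : (1 : ℝ) < k := by exact_mod_cast (by omega : 1 < k)
  obtain ⟨S, q, hq⟩ : ∃ (S : Finset Γ) (q : S → Fin k),
      ∀ x : Γ → Fin k, S.restrict x = q → x ∈ U := by
    obtain ⟨y, hy⟩ := hUne
    obtain ⟨S, u, hu, hSU⟩ := isOpen_pi_iff.mp hUopen y hy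
    refine ⟨S, S.restrict y, fun x hx => hSU fun i hi => ?_⟩
    have hxi : x i = y i := congrFun hx ⟨i, hi⟩
    rw [hxi]
    exact (hu i hi).2
  -- All conditions but the first hold strictly at `β = 1/k`, where the last two left sides are
  -- `1/k` and `1 - k ^ (-|S|)`; by continuity they persist slightly to the right.
  obtain ⟨β, hβk, hβ1, hβh, hβ2, hβS⟩ : ∃ β : ℝ, (k : ℝ)⁻¹ < β ∧ β < 1 ∧
      h < Real.logb 2 β⁻¹ ∧ k * β ^ 2 < 1 ∧ ((k : ℝ) ^ S.card - 1) * β ^ S.card < 1 := by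
    have c1 : ∀ᶠ β : ℝ in 𝓝 (k : ℝ)⁻¹, β < 1 :=
      continuousAt_id.eventually_lt_const (inv_lt_one_of_one_lt₀ hk1)
    have c2 : ∀ᶠ β : ℝ in 𝓝 (k : ℝ)⁻¹, h < Real.logb 2 β⁻¹ := by
      have hc : ContinuousAt (fun β : ℝ => Real.log β⁻¹ / Real.log 2) (k : ℝ)⁻¹ := by
        refine ContinuousAt.div_const (ContinuousAt.log (continuousAt_inv₀ (by positivity)) ?_) _
        positivity
      refine hc.eventually_const_lt ?_
      simpa only [inv_inv, Real.logb] using hh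
    have c3 : ∀ᶠ β : ℝ in 𝓝 (k : ℝ)⁻¹, k * β ^ 2 < 1 := by
      have hc : ContinuousAt (fun β : ℝ => k * β ^ 2) (k : ℝ)⁻¹ := by fun_prop
      refine hc.eventually_lt_const ?_
      beta_reduce
      rw [sq, ← mul_assoc, mul_inv_cancel₀ hk0.ne', one_mul]
      exact inv_lt_one_of_one_lt₀ hk1
    have c4 : ∀ᶠ β : ℝ in 𝓝 (k : ℝ)⁻¹, ((k : ℝ) ^ S.card - 1) * β ^ S.card < 1 := by
      have hc : ContinuousAt (fun β : ℝ => ((k : ℝ) ^ S.card - 1) * β ^ S.card) (k : ℝ)⁻¹ := by fun_prop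
      refine hc.eventually_lt_const ?_
      beta_reduce
      rw [sub_mul, ← mul_pow, mul_inv_cancel₀ hk0.ne', one_pow, one_mul]
      exact sub_lt_self _ (by positivity)
    have c0 : ∀ᶠ β : ℝ in 𝓝[>] (k : ℝ)⁻¹, (k : ℝ)⁻¹ < β := eventually_mem_nhdsWithin
    exact (c0.and (((c1.and (c2.and (c3.and c4))).filter_mono nhdsWithin_le_nhds))).exists
  have hβ : 0 < β := lt_trans (by positivity) hβk
  obtain ⟨E, hlight, hE⟩ := LargeSubshift.exists_isLight_forall (Γ := Γ) (A := Fin k) hβ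
    (by rw [Fintype.card_fin]; rwa [inv_lt_iff_one_lt_mul₀' hk0] at hβk)
    (by rwa [Fintype.card_fin])
  have havoid : ∀ x ∈ LargeSubshift.forbid E, ∀ P ∈ E, ¬ LargeSubshift.Matches P x :=
    fun x hx P hP => by simpa only [LargeSubshift.shift_one] using hx P hP 1
  have hX : LargeSubshift.AvoidsLightFamilies β (LargeSubshift.forbid E) :=
    fun Φ hΦ x hx => (hE x (havoid x hx)).1 Φ hΦ
  have hfree : LargeSubshift.IsFree (LargeSubshift.forbid E) :=
    fun γ x hx => (hE x (havoid x hx)).2 γ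
  have hXU := hX.subset_of_isOpen hβ hUinv hq hβS
  have hsub := LargeSubshift.isSubshift_forbid E
  have hne := hlight.forbid_nonempty hβ
  obtain ⟨Y, hYX, hY⟩ := hsub.exists_isMinimalSubshift hne
  have hcov := hX.hasHeavyCovers hYX hY.isSubshift hY.nonempty
  have hYfree : LargeSubshift.IsFree Y := fun γ x hx => hfree γ x (hYX hx)
  have hle : (h : EReal) ≤ ((Real.logb 2 β⁻¹ : ℝ) : EReal) := EReal.coe_le_coe_iff.mpr hβh.le
  -- The minimal `Y` serves (i) and (ii) through heavy covers; the sofic count concerns `forbid E`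
  -- itself, so (iii) uses the whole subshift.
  refine ⟨⟨Y, hY, hYfree, hYX.trans hXU, fun e => ?_⟩, fun _ => ⟨Y, hY, hYfree, hYX.trans hXU,
    fun F hF => hle.trans (hcov.le_folnerEntropy hβ hF)⟩, fun _ => ⟨LargeSubshift.forbid E, hsub,
    hne, hfree, hXU, fun S => hle.trans (hlight.le_soficEntropy hβ S)⟩⟩
  exact (ENNReal.ofReal_le_ofReal hβh.le).trans
    (hcov.le_hausdorffDim hβ hβ1 hY.isSubshift.isClosed.isCompact hY.nonempty e)
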